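/- Let $\nu>-1$, let $J_\nu(z)=(z/2)^\nu\sum_{k\ge0}\frac{(-z^2/4)^k}{k!\,\Gamma(\nu+k+1)}$ ($z>0$) be the Bessel function of the first kind, and let $0<\lambda_{1,\nu}<\lambda_{2,\nu}<\dots$ be its successive positive zeros. For $x\in(0,1)$ and $n\ge1$ put $$R^\nu(x)=\lambda_{1,\nu}\frac{J_{\nu+1}(\lambda_{1,\nu}x)}{J_\nu(\lambda_{1,\nu}x)},\qquad \phi_n^\nu(x)=\frac{\sqrt2}{|J_{\nu+1}(\lambda_{n,\nu})|}\,x^{-\nu}J_\nu(\lambda_{n,\nu}x),\qquad \psi_n^\nu(x)=x^{\nu+1/2}\phi_n^\nu(x),\qquad \varphi_n^\nu=\frac{\phi_n^\nu}{\phi_1^\nu},$$ consider on $(0,1)$ the measures $dx$, $d\mu_\nu(x)=x^{2\nu+1}\,dx$ and $d\eta_\nu(x)=x^{2\nu+1}[\phi_1^\nu(x)]^2\,dx$, and the first order differential operators $$d_\nu=\frac{d}{dx},\qquad \delta_\nu=\frac{d}{dx}+R^\nu(x),\qquad \mathbb{D}_\nu=\frac{d}{dx}-\frac{\nu+1/2}{x}+R^\nu(x).$$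 Then $\varphi_n^\nu$, $\phi_n^\nu$ and $\psi_n^\nu$ are differentiable on $(0,1)$ for all $n\ge1$, and: (a) the system $\{d_\nu\varphi_n^\nu: n\ge2\}$ is an orthogonal system of nonzero elements of $L^2(d\eta_\nu)$; (b) the system $\{\delta_\nu\phi_n^\nu: n\ge2\}$ is an orthogonal system of nonzero elements of $L^2(d\mu_\nu)$; (c) the system $\{\mathbb{D}_\nu\psi_n^\nu: n\ge2\}$ is an orthogonal system of nonzero elements of $L^2(dx)$. Moreover, for every $n\ge1$, $$\|d_\nu\varphi_n^\nu\|_{L^2(d\eta_\nu)}=\|\delta_\nu\phi_n^\nu\|_{L^2(d\mu_\nu)}=\|\mathbb{D}_\nu\psi_n^\nu\|_{L^2(dx)}=\sqrt{\lambda_{n,\nu}^2-\lambda_{1,\nu}^2}.$$ -/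

import Mathlib

open MeasureTheory Set

namespace FourierBessel

noncomputable section

/-- The Bessel function of the first kind `J_ν`, by its series (used for `ν > -1` and `z > 0`). -/
def besselJ (ν z : ℝ) : ℝ :=
  (z / 2) ^ ν * ∑' k : ℕ, (-(z ^ 2) / 4) ^ k / ((k.factorial : ℝ) * Real.Gamma (ν + k + 1))

/-- `besselZero ν n` for `n ≥ 1` is the `n`-th positive zero `λ_{n,ν}` of `J_ν`: the least zero larger
than the previous one, starting from the value `0` at the index `0`, which is not itself counted.
(For `ν > -1` the positive zeros of `J_ν` form an infinite set without accumulation points in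
`[0, ∞)`, so that each infimum is that of a nonempty set and is attained.) -/
def besselZero (ν : ℝ) : ℕ → ℝ
  | 0 => 0
  | n + 1 => sInf {z : ℝ | besselZero ν n < z ∧ besselJ ν z = 0}

/-- The function `R^ν = R^ν_1` on `(0,1)`. -/
def besselR (ν x : ℝ) : ℝ :=
  besselZero ν 1 * (besselJ (ν + 1) (besselZero ν 1 * x) / besselJ ν (besselZero ν 1 * x))

/-- The Fourier-Bessel functions `ϕ_n^ν` of the natural measure setting. -/
def phiNat (ν : ℝ) (n : ℕ) (x : ℝ) : ℝ :=
  Real.sqrt 2 / |besselJ (ν + 1) (besselZero ν n)| * (x ^ (-ν) * besselJ ν (besselZero ν n * x))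

/-- The Fourier-Bessel functions `ψ_n^ν` of the Lebesgue measure setting. -/
def psiLeb (ν : ℝ) (n : ℕ) (x : ℝ) : ℝ :=
  x ^ (ν + 1 / 2) * phiNat ν n x

/-- The Fourier-Bessel functions `φ_n^ν = ϕ_n^ν / ϕ_1^ν` of the essential measure setting. -/
def phiEss (ν : ℝ) (n : ℕ) (x : ℝ) : ℝ :=
  phiNat ν n x / phiNat ν 1 x

/-- Lebesgue measure on `(0,1)`. -/
def lebMeasure : Measure ℝ :=
  volume.restrict (Ioo 0 1)

/-- `dμ_ν(x) = x^{2ν+1} dx` on `(0,1)`. -/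
def natMeasure (ν : ℝ) : Measure ℝ :=
  lebMeasure.withDensity fun x => ENNReal.ofReal (x ^ (2 * ν + 1))

/-- `dη_ν(x) = x^{2ν+1} ϕ_1^ν(x)² dx` on `(0,1)`. -/
def essMeasure (ν : ℝ) : Measure ℝ :=
  lebMeasure.withDensity fun x => ENNReal.ofReal (x ^ (2 * ν + 1) * phiNat ν 1 x ^ 2)

/-- The derivative `d_ν = d/dx` of the essential measure setting; it does not depend on `ν`. -/
def essDeriv (f : ℝ → ℝ) (x : ℝ) : ℝ :=
  deriv f x

/-- The derivative `δ_ν = d/dx + R^ν(x)` of the natural measure setting. -/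
def natDeriv (ν : ℝ) (f : ℝ → ℝ) (x : ℝ) : ℝ :=
  deriv f x + besselR ν x * f x

/-- The derivative `𝔻_ν = d/dx - (ν + 1/2)/x + R^ν(x)` of the Lebesgue measure setting. -/
def lebDeriv (ν : ℝ) (f : ℝ → ℝ) (x : ℝ) : ℝ :=
  deriv f x - (ν + 1 / 2) / x * f x + besselR ν x * f x

/-- The functions `f n`, `n ∈ s`, are nonzero elements of the real space `L²(μ)` and are pairwise
orthogonal there. -/
def IsOrthogonalSystem (μ : Measure ℝ) (f : ℕ → ℝ → ℝ) (s : Set ℕ) : Prop :=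
  (∀ n ∈ s, MemLp (f n) 2 μ ∧ eLpNorm (f n) 2 μ ≠ 0) ∧
    s.Pairwise fun m n => ∫ x, f m x * f n x ∂μ = 0

end

end FourierBessel

open FourierBessel

/-! Write G_s(x) = E_ν(s x²/4), so that φ_n is a positive constant (`phiCoeff`) times G_s with s =
λ_n², and put T = G_t with t = λ_1². Bessel's equation reads (x^{2ν+1} G_s')' = -s x^{2ν+1} G_s.
Since R^ν = -T'/T on (0,1), all three derivatives reduce to the single function D_s = G_s' - (T'/T)
G_s = T (G_s/T)', and the weights are exactly those that turn each L² product into a multiple of ∫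
x^{2ν+1} D_u D_s.

The core is an integration by parts (`hasDerivAt_rpow_mul_besselG_mul_besselD`): with vanishing
boundary terms, ∫ x^{2ν+1} D_u D_s = (s - t) ∫ x^{2ν+1} G_u G_s. For s ≠ u the right side is zero by
the Wronskian identity; for s = u it is given by the energy identity, which is also the classical
normalization of φ_n. In the code the two identities are merged into one explicit primitive each, so
that only limits at 0 and 1 are needed.

The zeros λ_n are defined by infima, so they are first shown to exist (Sturm comparison), to be
simple (energy), and hence isolated. -/

namespace FourierBessel
open Filter Topology

noncomputable section

/-! ### The entire function E_ν: convergence, derivative, recurrence -/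

/-- The entire function `E_ν` with `J_ν(z) = (z/2)^ν E_ν(z²/4)`. -/
def besselE (ν w : ℝ) : ℝ :=
  ∑' k : ℕ, (-w) ^ k / ((k.factorial : ℝ) * Real.Gamma (ν + k + 1))

lemma besselJ_eq_rpow_mul_besselE (ν z : ℝ) :
    besselJ ν z = (z / 2) ^ ν * besselE ν (z ^ 2 / 4) := by
  simp only [besselJ, besselE, neg_div]

lemma gamma_add_nat_pos {ν : ℝ} (hν : -1 < ν) (k : ℕ) : 0 < Real.Gamma (ν + k + 1) := by
  apply Real.Gamma_pos_of_pos
  have : (0 : ℝ) ≤ k := k.cast_nonneg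
  linarith

lemma gamma_add_nat_succ {ν : ℝ} (hν : -1 < ν) (k : ℕ) :
    Real.Gamma (ν + 1 + k + 1) = (ν + k + 1) * Real.Gamma (ν + k + 1) := by
  have : (0 : ℝ) ≤ k := k.cast_nonneg
  rw [← Real.Gamma_add_one (by linarith)]
  congr 1; ring

lemma summable_besselE {ν : ℝ} (hν : -1 < ν) (w : ℝ) :
    Summable fun k : ℕ => w ^ k / ((k.factorial : ℝ) * Real.Gamma (ν + k + 1)) := by
  rcases eq_or_ne w 0 with rfl | hw
  · apply summable_of_ne_finset_zero (s := {0})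
    intro k hk
    simp only [Finset.mem_singleton] at hk
    simp [hk]
  have hpos : ∀ k : ℕ, 0 < (k.factorial : ℝ) * Real.Gamma (ν + k + 1) := fun k =>
    mul_pos (by positivity) (gamma_add_nat_pos hν k)
  refine summable_of_ratio_test_tendsto_lt_one (l := 0) zero_lt_one ?_ ?_
  · exact Eventually.of_forall fun k => div_ne_zero (pow_ne_zero _ hw) (hpos k).ne'
  · have key : ∀ k : ℕ, ‖w ^ (k + 1) / (((k + 1).factorial : ℝ) *
        Real.Gamma (ν + (k + 1 : ℕ) + 1))‖ /
        ‖w ^ k / ((k.factorial : ℝ) * Real.Gamma (ν + k + 1))‖ =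
        |w| * ((1 / ((k : ℝ) + 1)) * (ν + 1 + k)⁻¹) := by
      intro k
      have h0 : (0 : ℝ) ≤ k := k.cast_nonneg
      have h1 : 0 < ν + 1 + k := by linarith
      have h2 := gamma_add_nat_pos hν k
      have h3 : Real.Gamma (ν + (k + 1 : ℕ) + 1) = (ν + 1 + k) * Real.Gamma (ν + k + 1) := by
        have := gamma_add_nat_succ hν k
        push_cast
        rw [show ν + ((k : ℝ) + 1) + 1 = ν + 1 + k + 1 by ring, this]; ring
      have h4 : 0 < (k.factorial : ℝ) := by positivity
      have hw' : 0 < |w| := abs_pos.2 hw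
      rw [h3, Nat.factorial_succ, norm_div, norm_div, norm_pow, norm_pow, Real.norm_eq_abs w,
        Real.norm_of_nonneg (hpos k).le, Real.norm_of_nonneg (by positivity)]
      push_cast
      field_simp
      ring
    simp only [key]
    have h1 : Tendsto (fun k : ℕ => (ν + 1 + (k : ℝ))⁻¹) atTop (𝓝 0) :=
      tendsto_inv_atTop_zero.comp
        (tendsto_atTop_add_const_left _ _ tendsto_natCast_atTop_atTop)
    have h2 := (tendsto_one_div_add_atTop_nhds_zero_nat (𝕜 := ℝ)).mul h1
    simpa using h2.const_mul |w|

lemma hasDerivAt_besselE {ν : ℝ} (hν : -1 < ν) (w : ℝ) :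
    HasDerivAt (besselE ν) (-besselE (ν + 1) w) w := by
  set R := |w| + 1 with hR
  have hν1 : -1 < ν + 1 := by linarith
  let g' : ℕ → ℝ → ℝ := fun k y =>
    -(k * (-y) ^ (k - 1)) / ((k.factorial : ℝ) * Real.Gamma (ν + k + 1))
  have hg'succ : ∀ (k : ℕ) (y : ℝ), g' (k + 1) y =
      -((-y) ^ k / ((k.factorial : ℝ) * Real.Gamma (ν + 1 + k + 1))) := by
    intro k y
    have h4 : (k.factorial : ℝ) ≠ 0 := by positivity
    have h5 : (k : ℝ) + 1 ≠ 0 := by positivity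
    have h6 := (gamma_add_nat_pos hν1 k).ne'
    simp only [g', Nat.factorial_succ, Nat.add_sub_cancel]
    push_cast
    rw [show ν + ((k : ℝ) + 1) + 1 = ν + 1 + k + 1 by ring]
    field_simp
  have hu : Summable fun k : ℕ => |k * R ^ (k - 1) /
      ((k.factorial : ℝ) * Real.Gamma (ν + k + 1))| := by
    -- The term k = 0 carries the factor k = 0, so the truncated k - 1 is harmless; the shifted
    -- series is that of E_{ν+1} at -R.
    rw [← summable_nat_add_iff 1]
    refine (summable_besselE hν1 R).congr fun k => ?_
    have := hg'succ k (-R)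
    simp only [g', neg_neg] at this
    rw [neg_div, neg_inj] at this
    rw [this, abs_of_nonneg]
    exact div_nonneg (by positivity)
      (mul_nonneg (by positivity) (gamma_add_nat_pos hν1 k).le)
  have hw : w ∈ Metric.ball (0 : ℝ) R := by simp [hR]
  have main := hasDerivAt_tsum_of_isPreconnected hu Metric.isOpen_ball
    (convex_ball (0 : ℝ) R).isPreconnected
    (g := fun (k : ℕ) y => (-y) ^ k / ((k.factorial : ℝ) * Real.Gamma (ν + k + 1))) (g' := g')
    (fun k y _ => by
      have := ((hasDerivAt_neg y).pow k).div_const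
        ((k.factorial : ℝ) * Real.Gamma (ν + k + 1))
      simpa [g'] using this)
    (fun k y hy => by
      have hy' : |y| ≤ R := by
        have := mem_ball_zero_iff.1 hy
        exact this.le
      simp only [g', Real.norm_eq_abs, abs_div, abs_neg, abs_mul, abs_pow]
      have hR0 : 0 ≤ R := by positivity
      rw [abs_of_nonneg hR0]
      gcongr)
    hw (summable_besselE hν (-w)) hw
  refine main.congr_deriv ?_
  have hs : Summable fun k => g' k w := by
    rw [← summable_nat_add_iff 1]
    simp only [hg'succ]
    exact (summable_besselE hν1 (-w)).neg
  rw [hs.tsum_eq_zero_add]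
  simp only [hg'succ, tsum_neg]
  simp [g', besselE]

/-- The relation J_ν + J_{ν+2} = (2(ν+1)/z) J_{ν+1} with powers of z/2 removed. It follows termwise
from Γ(ν+k+2) = (ν+k+1) Γ(ν+k+1), on splitting ν+k+1 into ν+1 and k. -/
lemma besselE_recurrence {ν : ℝ} (hν : -1 < ν) (w : ℝ) :
    besselE ν w = (ν + 1) * besselE (ν + 1) w - w * besselE (ν + 2) w := by
  have hν1 : -1 < ν + 1 := by linarith
  have hν2 : -1 < ν + 2 := by linarith
  let f : ℕ → ℝ := fun k => k * ((-w) ^ k / ((k.factorial : ℝ) * Real.Gamma (ν + 1 + k + 1)))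
  have hf : ∀ k : ℕ, f (k + 1) =
      -w * ((-w) ^ k / ((k.factorial : ℝ) * Real.Gamma (ν + 2 + k + 1))) := by
    intro k
    have h4 : (k.factorial : ℝ) ≠ 0 := by positivity
    have h5 : (k : ℝ) + 1 ≠ 0 := by positivity
    have h6 := (gamma_add_nat_pos hν2 k).ne'
    simp only [f, Nat.factorial_succ]
    push_cast
    rw [show ν + 1 + ((k : ℝ) + 1) + 1 = ν + 2 + k + 1 by ring]
    field_simp
    ring
  have hs1 := summable_besselE hν1 (-w)
  have hs2 := (summable_besselE hν2 (-w)).mul_left (-w)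
  have hsf : Summable f := by
    rw [← summable_nat_add_iff 1]
    simpa only [hf] using hs2
  have e1 : ∑' k, f k = -w * besselE (ν + 2) w := by
    rw [hsf.tsum_eq_zero_add]
    simp only [hf, tsum_mul_left]
    simp [f, besselE]
  have e2 : besselE ν w = ∑' k : ℕ, ((ν + 1) *
      ((-w) ^ k / ((k.factorial : ℝ) * Real.Gamma (ν + 1 + k + 1))) + f k) := by
    refine tsum_congr fun k => ?_
    have h0 : (0 : ℝ) ≤ k := k.cast_nonneg
    have h4 : (k.factorial : ℝ) ≠ 0 := by positivity
    have h5 : ν + k + 1 ≠ 0 := by linarith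
    have h6 := (gamma_add_nat_pos hν k).ne'
    simp only [f, gamma_add_nat_succ hν k]
    field_simp
    ring
  rw [e2, (hs1.mul_left (ν + 1)).tsum_add hsf, tsum_mul_left, e1, ← besselE]
  ring

lemma besselE_zero {ν : ℝ} (hν : -1 < ν) : 0 < besselE ν 0 := by
  have : besselE ν 0 = 1 / Real.Gamma (ν + 1) := by
    rw [besselE, tsum_eq_single 0 (fun k hk => by simp [hk])]
    simp
  rw [this]
  exact div_pos one_pos (Real.Gamma_pos_of_pos (by linarith))

/-! ### The rescaled functions G_s and Bessel's equation -/

/-- `x ↦ E_ν(s x²/4)`, a multiple of `x^{-ν} J_ν(√s x)`. -/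
def besselG (ν s x : ℝ) : ℝ := besselE ν (s * x ^ 2 / 4)

/-- The function whose product with `x` is the derivative of `besselG ν s`. -/
def besselGDeriv (ν s x : ℝ) : ℝ := -(s / 2) * besselE (ν + 1) (s * x ^ 2 / 4)

lemma continuous_besselG {ν : ℝ} (hν : -1 < ν) (s : ℝ) : Continuous (besselG ν s) := by
  have : Continuous (besselE ν) :=
    continuous_iff_continuousAt.2 fun w => (hasDerivAt_besselE hν w).continuousAt
  unfold besselG
  fun_prop

lemma continuous_besselGDeriv {ν : ℝ} (hν : -1 < ν) (s : ℝ) :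
    Continuous (besselGDeriv ν s) :=
  (continuous_besselG (ν := ν + 1) (by linarith) s).const_mul _

lemma hasDerivAt_besselG {ν : ℝ} (hν : -1 < ν) (s x : ℝ) :
    HasDerivAt (besselG ν s) (x * besselGDeriv ν s x) x := by
  have h : HasDerivAt (fun x : ℝ => s * x ^ 2 / 4) (s * (2 * x) / 4) x := by
    simpa using ((hasDerivAt_pow 2 x).const_mul s).div_const 4
  refine ((hasDerivAt_besselE hν _).comp x h).congr_deriv ?_
  simp only [besselGDeriv]; ring

/-- With G' = xH, this is the equation G'' + (2ν+1)/x · G' + sG = 0 in first-order form. Unlike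
G'/x, the function H is manifestly continuous at 0. -/
lemma hasDerivAt_besselGDeriv {ν : ℝ} (hν : -1 < ν) (s : ℝ) {x : ℝ} (hx : x ≠ 0) :
    HasDerivAt (besselGDeriv ν s)
      ((-(2 * ν + 2) * besselGDeriv ν s x - s * besselG ν s x) / x) x := by
  have h : HasDerivAt (fun x : ℝ => s * x ^ 2 / 4) (s * (2 * x) / 4) x := by
    simpa using ((hasDerivAt_pow 2 x).const_mul s).div_const 4
  refine (((hasDerivAt_besselE (ν := ν + 1) (by linarith) _).comp x h).const_mul
    (-(s / 2))).congr_deriv ?_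
  have := besselE_recurrence hν (s * x ^ 2 / 4)
  rw [show ν + 1 + 1 = ν + 2 by ring]
  simp only [besselGDeriv, besselG, this]
  field_simp
  ring

lemma besselG_zero_pos {ν : ℝ} (hν : -1 < ν) (s : ℝ) : 0 < besselG ν s 0 := by
  simpa [besselG] using besselE_zero hν

lemma hasDerivAt_rpow_two_mul_add_two (ν : ℝ) {x : ℝ} (hx : 0 < x) :
    HasDerivAt (fun x : ℝ => x ^ (2 * ν + 2)) ((2 * ν + 2) * x ^ (2 * ν + 2) / x) x := by
  refine (Real.hasDerivAt_rpow_const (p := 2 * ν + 2) (Or.inl hx.ne')).congr_deriv ?_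
  rw [Real.rpow_sub_one hx.ne']; ring

/-! ### Energy identity and simplicity of the zeros -/

/-- A primitive of `2 s x^{2ν+1} G²` for `G = besselG ν s`, as `x^{2ν+2}` times this function. -/
def besselEnergy (ν s x : ℝ) : ℝ :=
  x ^ 2 * besselGDeriv ν s x ^ 2 + s * besselG ν s x ^ 2
    + 2 * ν * (besselG ν s x * besselGDeriv ν s x)

lemma continuous_besselEnergy {ν : ℝ} (hν : -1 < ν) (s : ℝ) :
    Continuous (besselEnergy ν s) := by
  have := continuous_besselG hν s
  have := continuous_besselGDeriv hν s
  unfold besselEnergy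
  fun_prop

/-- In terms of y = x^ν G the primitive is (xy')² + (s x² - ν²) y², and the identity is x(xy')' + (s
x² - ν²) y = 0 multiplied by 2xy'. -/
lemma hasDerivAt_rpow_mul_besselEnergy {ν : ℝ} (hν : -1 < ν) (s : ℝ) {x : ℝ} (hx : 0 < x) :
    HasDerivAt (fun x => x ^ (2 * ν + 2) * besselEnergy ν s x)
      (2 * s * (x ^ (2 * ν + 2) / x) * besselG ν s x ^ 2) x := by
  have hg := hasDerivAt_besselG hν s x
  have hd := hasDerivAt_besselGDeriv hν s hx.ne'
  refine ((hasDerivAt_rpow_two_mul_add_two ν hx).mul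
    ((((hasDerivAt_pow 2 x).mul (hd.pow 2)).add ((hg.pow 2).const_mul s)).add
      ((hg.mul hd).const_mul (2 * ν)))).congr_deriv ?_
  simp only [Pi.mul_apply, Pi.pow_apply, Pi.add_apply]
  field_simp
  push_cast
  ring

lemma tendsto_rpow_mul_zero {ν : ℝ} (hν : -1 < ν) {f : ℝ → ℝ} (hf : ContinuousAt f 0) :
    Tendsto (fun x : ℝ => x ^ (2 * ν + 2) * f x) (𝓝[>] 0) (𝓝 0) := by
  have h1 : ContinuousAt (fun x : ℝ => x ^ (2 * ν + 2)) 0 :=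
    Real.continuousAt_rpow_const _ _ (Or.inr (by linarith))
  have h2 := (h1.mul hf).tendsto.mono_left (nhdsWithin_le_nhds (s := Ioi 0))
  simp only [Pi.mul_apply, Real.zero_rpow (show 2 * ν + 2 ≠ 0 by linarith), zero_mul] at h2
  exact h2

/-- The positive zeros of `besselG ν s` are simple. -/
lemma besselGDeriv_ne_zero {ν : ℝ} (hν : -1 < ν) {s : ℝ} (hs : 0 < s) {x : ℝ} (hx : 0 < x)
    (hg : besselG ν s x = 0) : besselGDeriv ν s x ≠ 0 := by
  intro hd
  set K : ℝ → ℝ := fun x => x ^ (2 * ν + 2) * besselEnergy ν s x with hK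
  -- At a double zero, K would increase from 0 to 0, so K' and with it G would vanish on (0, x),
  -- against G(0) > 0.
  have hmono : MonotoneOn K (Icc 0 x) := by
    refine monotoneOn_of_hasDerivWithinAt_nonneg (convex_Icc 0 x)
      (f' := fun x => 2 * s * (x ^ (2 * ν + 2) / x) * besselG ν s x ^ 2) ?_ ?_ ?_
    · exact (((Real.continuous_rpow_const (by linarith)).mul
        (continuous_besselEnergy hν s))).continuousOn
    · intro y hy
      rw [interior_Icc] at hy
      exact (hasDerivAt_rpow_mul_besselEnergy hν s hy.1).hasDerivWithinAt
    · intro y hy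
      rw [interior_Icc] at hy
      have := hy.1
      positivity
  have hK0 : K 0 = 0 := by simp [hK, Real.zero_rpow (show 2 * ν + 2 ≠ 0 by linarith)]
  have hKx : K x = 0 := by simp [hK, besselEnergy, hg, hd]
  have hconst : ∀ y ∈ Icc 0 x, K y = 0 := fun y hy => le_antisymm
    (hKx ▸ hmono hy (right_mem_Icc.2 hx.le) hy.2) (hK0 ▸ hmono (left_mem_Icc.2 hx.le) hy hy.1)
  have hzero : ∀ y ∈ Ioo 0 x, besselG ν s y = 0 := by
    intro y hy
    have h1 : K =ᶠ[𝓝 y] fun _ => 0 := by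
      filter_upwards [isOpen_Ioo.mem_nhds hy] with z hz
      exact hconst z ⟨hz.1.le, hz.2.le⟩
    have h2 := (hasDerivAt_rpow_mul_besselEnergy hν s hy.1).unique
      ((hasDerivAt_const y (0 : ℝ)).congr_of_eventuallyEq h1)
    have := hy.1
    have h3 : 0 < 2 * s * (y ^ (2 * ν + 2) / y) := by positivity
    simpa [h3.ne'] using h2
  have h1 : Tendsto (besselG ν s) (𝓝[>] 0) (𝓝 (besselG ν s 0)) :=
    (continuous_besselG hν s).continuousAt.tendsto.mono_left nhdsWithin_le_nhds
  have h2 : Tendsto (besselG ν s) (𝓝[>] 0) (𝓝 0) := by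
    refine tendsto_const_nhds.congr' ?_
    filter_upwards [Ioo_mem_nhdsGT hx] with y hy
    exact (hzero y hy).symm
  exact (besselG_zero_pos hν s).ne' (tendsto_nhds_unique h1 h2)

/-! ### Existence and enumeration of the positive zeros -/

/-- Sturm comparison with `sin ((x - b) / 2)`: the zeros of `besselG ν 1` are unbounded. -/
lemma exists_besselG_zero_gt {ν : ℝ} (hν : -1 < ν) (a : ℝ) :
    ∃ z, a < z ∧ besselG ν 1 z = 0 := by
  by_contra! hne
  -- From x ≥ 2|ν| on one has ν²/x² ≤ 1/4, so the potential 1 + (1/4 - ν²)/x² of u = x^{ν+1/2} G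
  -- exceeds the potential 1/4 of v = sin((x - b)/2).
  set b := max (a + 1) (2 * |ν| + 1) with hb
  have hba : a < b := lt_of_lt_of_le (by linarith) (le_max_left _ _)
  have hbν : 2 * |ν| + 1 ≤ b := le_max_right _ _
  have hb0 : 0 < b := by have := abs_nonneg ν; linarith
  have hπ := Real.pi_pos
  set c := b + 2 * Real.pi with hc
  have hbc : b ≤ c := by linarith
  have hsign : ∀ y ∈ Icc b c, 0 < besselG ν 1 b * besselG ν 1 y := by
    intro y hy
    by_contra! hle
    have hc0 : ContinuousOn (fun y => besselG ν 1 b * besselG ν 1 y) (Icc b y) :=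
      ((continuous_besselG hν 1).const_mul _).continuousOn
    have hmem : (0 : ℝ) ∈ Icc (besselG ν 1 b * besselG ν 1 y)
      (besselG ν 1 b * besselG ν 1 b) := ⟨hle, mul_self_nonneg _⟩
    obtain ⟨t, ht, ht0⟩ := intermediate_value_Icc' hy.1 hc0 hmem
    rcases mul_eq_zero.1 ht0 with h | h
    · exact hne b hba h
    · exact hne t (hba.trans_le ht.1) h
  -- The Wronskian u'v - uv', multiplied by G(b) to fix the sign of G. On [b, c] the function v is a
  -- single positive arch.
  set T : ℝ → ℝ := fun x => besselG ν 1 b * (x ^ (ν + 1 / 2) *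
    ((x * besselGDeriv ν 1 x + (ν + 1 / 2) / x * besselG ν 1 x) * Real.sin ((x - b) / 2)
      - besselG ν 1 x * (Real.cos ((x - b) / 2) / 2))) with hT
  have hder : ∀ x, 0 < x → HasDerivAt T (besselG ν 1 b * (x ^ (ν + 1 / 2) *
      ((ν ^ 2 / x ^ 2 - 1 / (4 * x ^ 2) - 3 / 4) * besselG ν 1 x * Real.sin ((x - b) / 2))))
      x := by
    intro x hx
    have hg := hasDerivAt_besselG hν 1 x
    have hd := hasDerivAt_besselGDeriv hν 1 hx.ne'
    have hp : HasDerivAt (fun x : ℝ => x ^ (ν + 1 / 2))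
        ((ν + 1 / 2) * x ^ (ν + 1 / 2) / x) x := by
      refine (Real.hasDerivAt_rpow_const (p := ν + 1 / 2) (Or.inl hx.ne')).congr_deriv ?_
      rw [Real.rpow_sub_one hx.ne']; ring
    have hl : HasDerivAt (fun x : ℝ => (x - b) / 2) (1 / 2) x :=
      ((hasDerivAt_id x).sub_const b).div_const 2
    have hi : HasDerivAt (fun x : ℝ => (ν + 1 / 2) / x) (-(ν + 1 / 2) / x ^ 2) x := by
      refine ((hasDerivAt_inv hx.ne').const_mul (ν + 1 / 2)).congr_deriv ?_
      ring
    refine ((hp.mul (((((hasDerivAt_id x).mul hd).add (hi.mul hg)).mul hl.sin).sub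
      (hg.mul (hl.cos.div_const 2)))).const_mul (besselG ν 1 b)).congr_deriv ?_
    simp only [Pi.mul_apply, Pi.sub_apply, Pi.add_apply, id]
    field_simp
    ring
  have hanti : AntitoneOn T (Icc b c) := by
    refine antitoneOn_of_hasDerivWithinAt_nonpos (convex_Icc b c)
      (fun x hx => (hder x (hb0.trans_le hx.1)).continuousAt.continuousWithinAt)
      (fun x hx => (hder x ?_).hasDerivWithinAt) ?_
    · rw [interior_Icc] at hx
      exact hb0.trans hx.1
    · intro x hx
      rw [interior_Icc] at hx
      have hx0 : 0 < x := hb0.trans hx.1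
      have h1 := hsign x ⟨hx.1.le, hx.2.le⟩
      have h2 : 0 ≤ Real.sin ((x - b) / 2) :=
        Real.sin_nonneg_of_nonneg_of_le_pi (by linarith [hx.1]) (by linarith [hx.2])
      have h3 : ν ^ 2 / x ^ 2 - 1 / (4 * x ^ 2) - 3 / 4 ≤ 0 := by
        have h4 : ν ^ 2 / x ^ 2 ≤ 1 / 4 := by
          rw [div_le_iff₀ (by positivity), ← sq_abs ν]
          have := abs_nonneg ν
          nlinarith [hx.1]
        have h5 : 0 ≤ 1 / (4 * x ^ 2) := by positivity
        linarith
      have h6 : 0 ≤ x ^ (ν + 1 / 2) := by positivity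
      have := mul_nonneg (mul_nonneg h6 h1.le) h2
      nlinarith
  -- At the ends v = 0 and v' = ±1/2, so T(b) < 0 < T(c), although T is decreasing.
  have hle := hanti (left_mem_Icc.2 hbc) (right_mem_Icc.2 hbc) hbc
  have hcb : (c - b) / 2 = Real.pi := by rw [hc]; ring
  simp only [hT, hcb, sub_self, zero_div, Real.sin_zero, Real.cos_zero, Real.sin_pi,
    Real.cos_pi] at hle
  have h1 := mul_pos (hsign b (left_mem_Icc.2 hbc)) (Real.rpow_pos_of_pos hb0 (ν + 1 / 2))
  have h2 := mul_pos (hsign c (right_mem_Icc.2 hbc))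
    (Real.rpow_pos_of_pos (hb0.trans_le hbc) (ν + 1 / 2))
  nlinarith

lemma eventually_besselG_ne_zero {ν : ℝ} (hν : -1 < ν) {a : ℝ} (ha : 0 ≤ a) :
    ∀ᶠ z in 𝓝[>] a, besselG ν 1 z ≠ 0 := by
  by_cases h : besselG ν 1 a = 0
  · have ha0 : 0 < a := lt_of_le_of_ne ha (by
      rintro rfl
      exact (besselG_zero_pos hν 1).ne' h)
    have := (hasDerivAt_besselG hν 1 a).eventually_ne
      (mul_ne_zero ha0.ne' (besselGDeriv_ne_zero hν one_pos ha0 h)) (c := 0)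
    exact nhdsWithin_mono a (fun z hz => ne_of_gt hz) this
  · exact nhdsWithin_le_nhds ((continuous_besselG hν 1).continuousAt.eventually_ne h)

lemma besselJ_eq_zero_iff {ν z : ℝ} (hz : 0 < z) :
    besselJ ν z = 0 ↔ besselG ν 1 z = 0 := by
  have : (z / 2) ^ ν ≠ 0 := (Real.rpow_pos_of_pos (by positivity) _).ne'
  simp [besselJ_eq_rpow_mul_besselE, besselG, this]

lemma besselZero_succ_spec {ν : ℝ} (hν : -1 < ν) {n : ℕ} (h0 : 0 ≤ besselZero ν n) :
    besselZero ν n < besselZero ν (n + 1) ∧ besselG ν 1 (besselZero ν (n + 1)) = 0 := by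
  set a := besselZero ν n with ha
  have hdef : besselZero ν (n + 1) = sInf {z : ℝ | a < z ∧ besselG ν 1 z = 0} := by
    simp only [besselZero, ← ha]
    congr 1
    ext z
    simp only [mem_ofPred_eq]
    exact and_congr_right fun hz => besselJ_eq_zero_iff (h0.trans_lt hz)
  set S := {z : ℝ | a < z ∧ besselG ν 1 z = 0} with hS
  obtain ⟨z₀, hz₀⟩ : S.Nonempty := exists_besselG_zero_gt hν a
  obtain ⟨b, hab, hb⟩ : ∃ b, a < b ∧ ∀ z ∈ Ioo a b, besselG ν 1 z ≠ 0 := by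
    have := eventually_besselG_ne_zero hν h0
    obtain ⟨b, hab, hb⟩ := mem_nhdsGT_iff_exists_Ioo_subset.1 this
    exact ⟨b, hab, hb⟩
  -- No zero lies just to the right of a, so the strict bound can be replaced by a closed one and
  -- the infimum is attained.
  have hSeq : S = {z : ℝ | b ≤ z ∧ besselG ν 1 z = 0} := by
    ext z
    refine ⟨fun hz => ⟨?_, hz.2⟩, fun hz => ⟨hab.trans_le hz.1, hz.2⟩⟩
    by_contra! hlt
    exact hb z ⟨hz.1, hlt⟩ hz.2
  have hclosed : IsClosed S := by
    rw [hSeq]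
    exact isClosed_Ici.inter (isClosed_eq (continuous_besselG hν 1) continuous_const)
  have hmem : sInf S ∈ S := hclosed.csInf_mem ⟨z₀, hz₀⟩ ⟨a, fun z hz => hz.1.le⟩
  rw [hdef]
  exact hmem

lemma besselZero_nonneg {ν : ℝ} (hν : -1 < ν) (n : ℕ) : 0 ≤ besselZero ν n := by
  induction n with
  | zero => simp [besselZero]
  | succ n ih => exact ih.trans (besselZero_succ_spec hν ih).1.le

lemma besselZero_strictMono {ν : ℝ} (hν : -1 < ν) : StrictMono (besselZero ν) :=
  strictMono_nat_of_lt_succ fun n => (besselZero_succ_spec hν (besselZero_nonneg hν n)).1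

lemma besselZero_pos {ν : ℝ} (hν : -1 < ν) {n : ℕ} (hn : 1 ≤ n) : 0 < besselZero ν n := by
  simpa [besselZero] using besselZero_strictMono hν (show 0 < n from hn)

lemma besselG_sq (ν l x : ℝ) : besselG ν (l ^ 2) x = besselG ν 1 (l * x) := by
  simp only [besselG]; congr 1; ring

lemma besselG_besselZero {ν : ℝ} (hν : -1 < ν) {n : ℕ} (hn : 1 ≤ n) :
    besselG ν (besselZero ν n ^ 2) 1 = 0 := by
  obtain ⟨m, rfl⟩ := Nat.exists_eq_add_of_le' hn
  rw [besselG_sq, mul_one]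
  exact (besselZero_succ_spec hν (besselZero_nonneg hν m)).2

/-- By minimality of λ_1: hence R^ν and the quotients φ_n/φ_1 have no singularity inside (0,1). -/
lemma besselG_besselZero_one_ne_zero {ν : ℝ} (hν : -1 < ν) {x : ℝ} (hx : x ∈ Ioo (0 : ℝ) 1) :
    besselG ν (besselZero ν 1 ^ 2) x ≠ 0 := by
  intro h
  have hl := besselZero_pos hν (le_refl 1)
  rw [besselG_sq] at h
  have hlx : 0 < besselZero ν 1 * x := mul_pos hl hx.1
  have h1 : besselZero ν 1 ≤ besselZero ν 1 * x := by
    conv_lhs => rw [besselZero]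
    exact csInf_le ⟨0, fun z hz => by simpa [besselZero] using hz.1.le⟩
      ⟨by simpa [besselZero] using hlx, (besselJ_eq_zero_iff hlx).2 h⟩
  nlinarith [hx.2]

/-! ### Integrals of the products D_u D_s -/

/-- `G' - (T'/T) G` for `G = besselG ν s` and `T = besselG ν t`. -/
def besselD (ν t s x : ℝ) : ℝ :=
  x * (besselGDeriv ν s x - besselGDeriv ν t x / besselG ν t x * besselG ν s x)

lemma continuousOn_besselD {ν : ℝ} (hν : -1 < ν) {t : ℝ} (s : ℝ) {S : Set ℝ}
    (hS : ∀ x ∈ S, besselG ν t x ≠ 0) : ContinuousOn (besselD ν t s) S := by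
  have h1 := (continuous_besselG hν s).continuousOn (s := S)
  have h2 := (continuous_besselG hν t).continuousOn (s := S)
  have h3 := (continuous_besselGDeriv hν s).continuousOn (s := S)
  have h4 := (continuous_besselGDeriv hν t).continuousOn (s := S)
  exact continuousOn_id.mul (h3.sub ((h4.div h2 hS).mul h1))

/-- The differentiated function is x^{2ν+1} G_u D_s. The identity expresses that D and its formal
adjoint factor the Bessel operator shifted by t. -/
lemma hasDerivAt_rpow_mul_besselG_mul_besselD {ν : ℝ} (hν : -1 < ν) (t s u : ℝ) {x : ℝ}
    (hx : 0 < x) (ht : besselG ν t x ≠ 0) :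
    HasDerivAt (fun x => x ^ (2 * ν + 2) * (besselG ν u x *
        (besselGDeriv ν s x - besselGDeriv ν t x / besselG ν t x * besselG ν s x)))
      (x ^ (2 * ν + 2) / x * (besselD ν t u x * besselD ν t s x)
        - (s - t) * (x ^ (2 * ν + 2) / x * (besselG ν u x * besselG ν s x))) x := by
  have hg := fun s => hasDerivAt_besselG hν s x
  have hd := fun s => hasDerivAt_besselGDeriv hν s hx.ne'
  refine ((hasDerivAt_rpow_two_mul_add_two ν hx).mul
    ((hg u).mul ((hd s).sub (((hd t).div (hg t) ht).mul (hg s))))).congr_deriv ?_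
  simp only [Pi.mul_apply, Pi.sub_apply, Pi.div_apply, besselD]
  field_simp
  ring

/-- Lagrange's identity for two solutions of Bessel's equation; it yields the orthogonality of G_u
and G_s. -/
lemma hasDerivAt_rpow_mul_besselG_wronskian {ν : ℝ} (hν : -1 < ν) (s u : ℝ) {x : ℝ}
    (hx : 0 < x) :
    HasDerivAt (fun x => x ^ (2 * ν + 2) *
        (besselGDeriv ν u x * besselG ν s x - besselG ν u x * besselGDeriv ν s x))
      ((s - u) * (x ^ (2 * ν + 2) / x * (besselG ν u x * besselG ν s x))) x := by
  have hg := fun s => hasDerivAt_besselG hν s x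
  have hd := fun s => hasDerivAt_besselGDeriv hν s hx.ne'
  refine ((hasDerivAt_rpow_two_mul_add_two ν hx).mul
    (((hd u).mul (hg s)).sub ((hg u).mul (hd s)))).congr_deriv ?_
  simp only [Pi.mul_apply, Pi.sub_apply]
  field_simp
  ring

lemma tendsto_div_of_hasDerivAt {f g : ℝ → ℝ} {a f' g' : ℝ} (hf : HasDerivAt f f' a)
    (hg : HasDerivAt g g' a) (hfa : f a = 0) (hga : g a = 0) (hg' : g' ≠ 0) :
    Tendsto (fun x => f x / g x) (𝓝[≠] a) (𝓝 (f' / g')) := by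
  refine (hf.tendsto_slope.div hg.tendsto_slope hg').congr' ?_
  filter_upwards [self_mem_nhdsWithin] with x hx
  have hx' : x - a ≠ 0 := sub_ne_zero.2 hx
  simp only [Pi.div_apply, slope_def_field, hfa, hga, sub_zero]
  field_simp

lemma tendsto_besselG_mul_besselD_zero {ν : ℝ} (hν : -1 < ν) (t s u : ℝ) :
    Tendsto (fun x => x ^ (2 * ν + 2) * (besselG ν u x *
        (besselGDeriv ν s x - besselGDeriv ν t x / besselG ν t x * besselG ν s x)))
      (𝓝[>] 0) (𝓝 0) := by
  have hg := fun s => (continuous_besselG hν s).continuousAt (x := 0)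
  have hd := fun s => (continuous_besselGDeriv hν s).continuousAt (x := 0)
  exact tendsto_rpow_mul_zero hν ((hg u).mul ((hd s).sub
    (((hd t).div (hg t) (besselG_zero_pos hν t).ne').mul (hg s))))

lemma tendsto_besselG_mul_besselD_one {ν : ℝ} (hν : -1 < ν) {t s u : ℝ} (ht : 0 < t)
    (ht1 : besselG ν t 1 = 0) (hs1 : besselG ν s 1 = 0) (hu1 : besselG ν u 1 = 0) :
    Tendsto (fun x => x ^ (2 * ν + 2) * (besselG ν u x *
        (besselGDeriv ν s x - besselGDeriv ν t x / besselG ν t x * besselG ν s x)))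
      (𝓝[<] 1) (𝓝 0) := by
  have hle : 𝓝[<] (1 : ℝ) ≤ 𝓝[≠] 1 := nhdsWithin_mono _ fun x hx => ne_of_lt hx
  have hg : ∀ s, Tendsto (besselG ν s) (𝓝[<] 1) (𝓝 (besselG ν s 1)) := fun s =>
    (continuous_besselG hν s).continuousAt.tendsto.mono_left nhdsWithin_le_nhds
  have hd : ∀ s, Tendsto (besselGDeriv ν s) (𝓝[<] 1) (𝓝 (besselGDeriv ν s 1)) := fun s =>
    (continuous_besselGDeriv hν s).continuousAt.tendsto.mono_left nhdsWithin_le_nhds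
  have hp : Tendsto (fun x : ℝ => x ^ (2 * ν + 2)) (𝓝[<] 1) (𝓝 (1 ^ (2 * ν + 2))) :=
    (Real.continuousAt_rpow_const _ _ (Or.inl one_ne_zero)).tendsto.mono_left
      nhdsWithin_le_nhds
  -- T'/T blows up at 1, but T has a simple zero there, so G_u/T has a finite limit and the
  -- remaining factor G_s tends to 0.
  have hq := (tendsto_div_of_hasDerivAt (hasDerivAt_besselG hν u 1) (hasDerivAt_besselG hν t 1)
    hu1 ht1 (by simpa using besselGDeriv_ne_zero hν ht one_pos ht1)).mono_left hle
  have := hp.mul (((hg u).mul (hd s)).sub (((hd t).mul hq).mul (hg s)))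
  simp only [hu1, hs1, zero_mul, mul_zero, sub_zero] at this
  refine this.congr fun x => ?_
  ring

/-- The fundamental theorem of calculus for a nonnegative derivative on an open interval. -/
lemma integrableOn_Ioo_and_integral_of_nonneg {f f' : ℝ → ℝ} {a b fa fb : ℝ} (hab : a < b)
    (hderiv : ∀ x ∈ Ioo a b, HasDerivAt f (f' x) x) (hpos : ∀ x ∈ Ioo a b, 0 ≤ f' x)
    (ha : Tendsto f (𝓝[>] a) (𝓝 fa)) (hb : Tendsto f (𝓝[<] b) (𝓝 fb)) :
    IntegrableOn f' (Ioo a b) ∧ ∫ x in Ioo a b, f' x = fb - fa := by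
  have hcont : ContinuousOn (extendFrom (Ioo a b) f) (Icc a b) :=
    continuousOn_Icc_extendFrom_Ioo
      (fun x hx => (hderiv x hx).continuousAt.continuousWithinAt) ha hb
  -- Integrability comes for free: the continuous extension of f to [a, b] has a nonnegative
  -- derivative inside.
  have hint : IntegrableOn f' (Ioc a b) := by
    refine intervalIntegral.integrableOn_deriv_of_nonneg hcont (fun x hx => ?_) hpos
    refine (hderiv x hx).congr_of_eventuallyEq ?_
    filter_upwards [isOpen_Ioo.mem_nhds hx] with y hy
    exact extendFrom_eq (subset_closure hy) ((hderiv y hy).continuousAt.continuousWithinAt)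
  refine ⟨hint.mono_set Ioo_subset_Ioc_self, ?_⟩
  rw [← integral_Ioc_eq_integral_Ioo, ← intervalIntegral.integral_of_le hab.le]
  exact intervalIntegral.integral_eq_sub_of_hasDerivAt_of_tendsto hab hderiv
    ((intervalIntegrable_iff_integrableOn_Ioc_of_le hab.le).2 hint) ha hb

lemma integral_besselD_sq {ν t : ℝ} (hν : -1 < ν) (ht : 0 < t) (ht1 : besselG ν t 1 = 0)
    (ht0 : ∀ x ∈ Ioo (0 : ℝ) 1, besselG ν t x ≠ 0) {s : ℝ} (hs : 0 < s)
    (hs1 : besselG ν s 1 = 0) :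
    IntegrableOn (fun x => x ^ (2 * ν + 2) / x * (besselD ν t s x * besselD ν t s x))
        (Ioo 0 1) ∧
      ∫ x in Ioo 0 1, x ^ (2 * ν + 2) / x * (besselD ν t s x * besselD ν t s x) =
        (s - t) * (besselGDeriv ν s 1 ^ 2 / (2 * s)) := by
  -- Adding (s - t)/(2s) times the energy cancels the G_s² term, leaving a primitive of x^{2ν+1}
  -- D_s² alone.
  have h0 := (tendsto_besselG_mul_besselD_zero hν t s s).add
    ((tendsto_rpow_mul_zero hν (continuous_besselEnergy hν s).continuousAt).const_mul
      ((s - t) / (2 * s)))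
  have hE : ContinuousAt (fun x => x ^ (2 * ν + 2) * besselEnergy ν s x) 1 :=
    (hasDerivAt_rpow_mul_besselEnergy hν s one_pos).continuousAt
  have h1 := (tendsto_besselG_mul_besselD_one hν ht ht1 hs1 hs1).add
    ((hE.tendsto.mono_left (nhdsWithin_le_nhds (s := Iio 1))).const_mul ((s - t) / (2 * s)))
  have := integrableOn_Ioo_and_integral_of_nonneg one_pos
    (f' := fun x => x ^ (2 * ν + 2) / x * (besselD ν t s x * besselD ν t s x)) (fun x hx =>
    ((hasDerivAt_rpow_mul_besselG_mul_besselD hν t s s hx.1 (ht0 x hx)).add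
      ((hasDerivAt_rpow_mul_besselEnergy hν s hx.1).const_mul
        ((s - t) / (2 * s)))).congr_deriv (by field_simp; ring))
    (fun x hx => mul_nonneg (by have := hx.1; positivity) (mul_self_nonneg _)) h0 h1
  refine ⟨this.1, this.2.trans ?_⟩
  simp only [besselEnergy, hs1, Real.one_rpow]
  ring

lemma integral_besselD_mul {ν t : ℝ} (hν : -1 < ν) (ht : 0 < t) (ht1 : besselG ν t 1 = 0)
    (ht0 : ∀ x ∈ Ioo (0 : ℝ) 1, besselG ν t x ≠ 0) {s u : ℝ} (hs : 0 < s) (hu : 0 < u)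
    (hs1 : besselG ν s 1 = 0) (hu1 : besselG ν u 1 = 0) (hsu : s ≠ u) :
    ∫ x in Ioo 0 1, x ^ (2 * ν + 2) / x * (besselD ν t u x * besselD ν t s x) = 0 := by
  have hsu' : s - u ≠ 0 := sub_ne_zero.2 hsu
  have hg := fun s => (continuous_besselG hν s).continuousAt (x := 0)
  have hd := fun s => (continuous_besselGDeriv hν s).continuousAt (x := 0)
  -- Here (s - t)/(s - u) times the Wronskian cancels the G_u G_s term.
  have h0 := (tendsto_besselG_mul_besselD_zero hν t s u).add
    ((tendsto_rpow_mul_zero hν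
      (((hd u).mul (hg s)).sub ((hg u).mul (hd s)))).const_mul ((s - t) / (s - u)))
  have h1 := (tendsto_besselG_mul_besselD_one hν ht ht1 hs1 hu1).add
    (((hasDerivAt_rpow_mul_besselG_wronskian hν s u one_pos).continuousAt.tendsto.mono_left
      (nhdsWithin_le_nhds (s := Iio 1))).const_mul ((s - t) / (s - u)))
  have hint : IntegrableOn
      (fun x => x ^ (2 * ν + 2) / x * (besselD ν t u x * besselD ν t s x)) (Ioo 0 1) := by
    have hcont := fun s => continuousOn_besselD (S := Ioo (0 : ℝ) 1) hν s ht0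
    have hp : ContinuousOn (fun x : ℝ => x ^ (2 * ν + 2) / x) (Ioo 0 1) :=
      (continuousOn_id.rpow_const fun x hx => Or.inl (ne_of_gt hx.1)).div continuousOn_id
        fun x hx => ne_of_gt hx.1
    -- The product has no sign, so integrability comes from |D_u D_s| ≤ D_u² + D_s².
    refine ((integral_besselD_sq hν ht ht1 ht0 hu hu1).1.add
      (integral_besselD_sq hν ht ht1 ht0 hs hs1).1).mono'
      ((hp.mul ((hcont u).mul (hcont s))).aestronglyMeasurable measurableSet_Ioo) ?_
    filter_upwards [ae_restrict_mem measurableSet_Ioo] with x hx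
    have hx0 : 0 ≤ x ^ (2 * ν + 2) / x := by have := hx.1; positivity
    simp only [Pi.add_apply]
    rw [norm_mul, Real.norm_of_nonneg hx0, ← mul_add]
    refine mul_le_mul_of_nonneg_left ?_ hx0
    rw [Real.norm_eq_abs, abs_le]
    constructor <;> nlinarith [sq_nonneg (besselD ν t u x + besselD ν t s x),
      sq_nonneg (besselD ν t u x - besselD ν t s x), sq_nonneg (besselD ν t u x),
      sq_nonneg (besselD ν t s x)]
  rw [← integral_Ioc_eq_integral_Ioo, ← intervalIntegral.integral_of_le zero_le_one,
    intervalIntegral.integral_eq_sub_of_hasDerivAt_of_tendsto one_pos (fun x hx =>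
      ((hasDerivAt_rpow_mul_besselG_mul_besselD hν t s u hx.1 (ht0 x hx)).add
        ((hasDerivAt_rpow_mul_besselG_wronskian hν s u hx.1).const_mul
          ((s - t) / (s - u)))).congr_deriv (by field_simp; ring))
      ((intervalIntegrable_iff_integrableOn_Ioo_of_le zero_le_one).2 hint) h0 h1]
  simp [hs1, hu1]

/-! ### From G_s to the Fourier-Bessel functions and their derivatives -/

/-- The factor relating `phiNat ν n` to `besselG`. -/
def phiCoeff (ν : ℝ) (n : ℕ) : ℝ :=
  Real.sqrt 2 / |besselJ (ν + 1) (besselZero ν n)| * (besselZero ν n / 2) ^ ν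

lemma phiNat_eq {ν : ℝ} (hν : -1 < ν) (n : ℕ) {x : ℝ} (hx : 0 < x) :
    phiNat ν n x = phiCoeff ν n * besselG ν (besselZero ν n ^ 2) x := by
  have hl := besselZero_nonneg hν n
  rw [phiNat, phiCoeff, besselJ_eq_rpow_mul_besselE ν, besselG,
    show besselZero ν n * x / 2 = besselZero ν n / 2 * x by ring,
    Real.mul_rpow (by positivity) hx.le, mul_pow, Real.rpow_neg hx.le]
  have := (Real.rpow_pos_of_pos hx ν).ne'
  field_simp

lemma besselJ_besselZero_eq (ν : ℝ) {n : ℕ} (hl : 0 < besselZero ν n) :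
    besselJ (ν + 1) (besselZero ν n) =
      -((besselZero ν n / 2) ^ ν * (besselGDeriv ν (besselZero ν n ^ 2) 1 / besselZero ν n)) := by
  rw [besselJ_eq_rpow_mul_besselE, besselGDeriv, Real.rpow_add_one (by positivity)]
  field_simp

lemma besselGDeriv_besselZero_ne_zero {ν : ℝ} (hν : -1 < ν) {n : ℕ} (hn : 1 ≤ n) :
    besselGDeriv ν (besselZero ν n ^ 2) 1 ≠ 0 :=
  besselGDeriv_ne_zero hν (pow_pos (besselZero_pos hν hn) 2) one_pos (besselG_besselZero hν hn)

lemma phiCoeff_pos {ν : ℝ} (hν : -1 < ν) {n : ℕ} (hn : 1 ≤ n) : 0 < phiCoeff ν n := by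
  have hl := besselZero_pos hν hn
  have h1 := besselGDeriv_besselZero_ne_zero hν hn
  have h2 : besselJ (ν + 1) (besselZero ν n) ≠ 0 := by
    have h3 : (besselZero ν n / 2) ^ ν ≠ 0 := (Real.rpow_pos_of_pos (by positivity) _).ne'
    rw [besselJ_besselZero_eq ν hl]
    exact neg_ne_zero.2 (mul_ne_zero h3 (div_ne_zero h1 hl.ne'))
  unfold phiCoeff
  positivity

/-- The normalization of φ_n in L²(dμ_ν): by the energy identity, H(1)²/(2λ_n²) is the integral of
x^{2ν+1} G² over (0,1). -/
lemma phiCoeff_sq_mul {ν : ℝ} (hν : -1 < ν) {n : ℕ} (hn : 1 ≤ n) :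
    phiCoeff ν n ^ 2 * (besselGDeriv ν (besselZero ν n ^ 2) 1 ^ 2 /
      (2 * besselZero ν n ^ 2)) = 1 := by
  have hl := besselZero_pos hν hn
  have h1 := besselGDeriv_besselZero_ne_zero hν hn
  have h3 : (besselZero ν n / 2) ^ ν ≠ 0 := (Real.rpow_pos_of_pos (by positivity) _).ne'
  rw [phiCoeff, besselJ_besselZero_eq ν hl, mul_pow, div_pow, sq_abs,
    Real.sq_sqrt (by norm_num)]
  field_simp

/-- That is, R^ν = -T'/T, the logarithmic derivative of φ_1 with the opposite sign. -/
lemma besselR_eq {ν : ℝ} (hν : -1 < ν) {x : ℝ} (hx : x ∈ Ioo (0 : ℝ) 1) :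
    besselR ν x = -(x * (besselGDeriv ν (besselZero ν 1 ^ 2) x /
      besselG ν (besselZero ν 1 ^ 2) x)) := by
  have hl := besselZero_pos hν le_rfl
  have hx0 := hx.1
  have h0 := besselG_besselZero_one_ne_zero hν hx
  rw [besselR, besselJ_eq_rpow_mul_besselE, besselJ_eq_rpow_mul_besselE,
    Real.rpow_add_one (by positivity)]
  simp only [besselG, besselGDeriv, mul_pow] at h0 ⊢
  have h3 : (besselZero ν 1 * x / 2) ^ ν ≠ 0 := (Real.rpow_pos_of_pos (by positivity) _).ne'
  field_simp

lemma hasDerivAt_phiNat {ν : ℝ} (hν : -1 < ν) (n : ℕ) {x : ℝ} (hx : 0 < x) :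
    HasDerivAt (phiNat ν n)
      (phiCoeff ν n * (x * besselGDeriv ν (besselZero ν n ^ 2) x)) x := by
  refine ((hasDerivAt_besselG hν _ x).const_mul (phiCoeff ν n)).congr_of_eventuallyEq ?_
  filter_upwards [lt_mem_nhds hx] with y hy
  exact phiNat_eq hν n hy

lemma phiNat_one_ne_zero {ν : ℝ} (hν : -1 < ν) {x : ℝ} (hx : x ∈ Ioo (0 : ℝ) 1) :
    phiNat ν 1 x ≠ 0 := by
  rw [phiNat_eq hν 1 hx.1]
  exact mul_ne_zero (phiCoeff_pos hν le_rfl).ne' (besselG_besselZero_one_ne_zero hν hx)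

lemma hasDerivAt_phiEss {ν : ℝ} (hν : -1 < ν) (n : ℕ) {x : ℝ} (hx : x ∈ Ioo (0 : ℝ) 1) :
    HasDerivAt (phiEss ν n) (phiCoeff ν n *
      besselD ν (besselZero ν 1 ^ 2) (besselZero ν n ^ 2) x / phiNat ν 1 x) x := by
  refine ((hasDerivAt_phiNat hν n hx.1).div (hasDerivAt_phiNat hν 1 hx.1)
    (phiNat_one_ne_zero hν hx)).congr_deriv ?_
  have h1 := (phiCoeff_pos hν le_rfl).ne'
  have h2 := besselG_besselZero_one_ne_zero hν hx
  rw [phiNat_eq hν 1 hx.1, phiNat_eq hν n hx.1, besselD]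
  field_simp

lemma hasDerivAt_psiLeb {ν : ℝ} (hν : -1 < ν) (n : ℕ) {x : ℝ} (hx : 0 < x) :
    HasDerivAt (psiLeb ν n) (x ^ (ν + 1 / 2) * ((ν + 1 / 2) / x * phiNat ν n x +
      phiCoeff ν n * (x * besselGDeriv ν (besselZero ν n ^ 2) x))) x := by
  refine ((Real.hasDerivAt_rpow_const (p := ν + 1 / 2) (Or.inl hx.ne')).mul
    (hasDerivAt_phiNat hν n hx)).congr_deriv ?_
  rw [Real.rpow_sub_one hx.ne']; ring

lemma essDeriv_phiEss {ν : ℝ} (hν : -1 < ν) (n : ℕ) {x : ℝ} (hx : x ∈ Ioo (0 : ℝ) 1) :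
    essDeriv (phiEss ν n) x = phiCoeff ν n *
      besselD ν (besselZero ν 1 ^ 2) (besselZero ν n ^ 2) x / phiNat ν 1 x :=
  (hasDerivAt_phiEss hν n hx).deriv

lemma natDeriv_phiNat {ν : ℝ} (hν : -1 < ν) (n : ℕ) {x : ℝ} (hx : x ∈ Ioo (0 : ℝ) 1) :
    natDeriv ν (phiNat ν n) x = phiCoeff ν n *
      besselD ν (besselZero ν 1 ^ 2) (besselZero ν n ^ 2) x := by
  rw [natDeriv, (hasDerivAt_phiNat hν n hx.1).deriv, besselR_eq hν hx, phiNat_eq hν n hx.1,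
    besselD]
  ring

lemma lebDeriv_psiLeb {ν : ℝ} (hν : -1 < ν) (n : ℕ) {x : ℝ} (hx : x ∈ Ioo (0 : ℝ) 1) :
    lebDeriv ν (psiLeb ν n) x = x ^ (ν + 1 / 2) * (phiCoeff ν n *
      besselD ν (besselZero ν 1 ^ 2) (besselZero ν n ^ 2) x) := by
  rw [lebDeriv, (hasDerivAt_psiLeb hν n hx.1).deriv, besselR_eq hν hx, psiLeb,
    phiNat_eq hν n hx.1, besselD]
  ring

/-! ### Norms and orthogonality in the weighted spaces -/

lemma eLpNorm_two_withDensity_lebMeasure {w f : ℝ → ℝ} {I : ℝ}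
    (hw : ContinuousOn w (Ioo 0 1)) (hw0 : ∀ x ∈ Ioo (0 : ℝ) 1, 0 ≤ w x)
    (hint : IntegrableOn (fun x => w x * (f x * f x)) (Ioo 0 1))
    (hI : ∫ x in Ioo 0 1, w x * (f x * f x) = I) :
    eLpNorm f 2 (lebMeasure.withDensity fun x => ENNReal.ofReal (w x)) =
      ENNReal.ofReal (Real.sqrt I) := by
  have hae : ∀ᵐ x ∂lebMeasure, x ∈ Ioo (0 : ℝ) 1 := ae_restrict_mem measurableSet_Ioo
  have hwm : AEMeasurable (fun x => ENNReal.ofReal (w x)) lebMeasure :=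
    (hw.aemeasurable measurableSet_Ioo).ennreal_ofReal
  have hnn : 0 ≤ᵐ[lebMeasure] fun x => w x * (f x * f x) := by
    filter_upwards [hae] with x hx
    exact mul_nonneg (hw0 x hx) (mul_self_nonneg _)
  have hI0 : 0 ≤ I := hI ▸ integral_nonneg_of_ae hnn
  rw [eLpNorm_eq_lintegral_rpow_enorm_toReal two_ne_zero ENNReal.ofNat_ne_top,
    lintegral_withDensity_eq_lintegral_mul_non_measurable₀ _ hwm
      (Eventually.of_forall fun _ => ENNReal.ofReal_lt_top)]
  have : ∫⁻ x, ((fun x => ENNReal.ofReal (w x)) * fun x => ‖f x‖ₑ ^ (2 : ENNReal).toReal) x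
      ∂lebMeasure = ENNReal.ofReal I := by
    rw [← hI]
    refine Eq.trans (lintegral_congr_ae ?_) (ofReal_integral_eq_lintegral_ofReal hint hnn).symm
    filter_upwards [hae] with x hx
    simp only [Pi.mul_apply, ENNReal.toReal_ofNat, ENNReal.rpow_ofNat]
    rw [ENNReal.ofReal_mul (hw0 x hx), ← Real.enorm_of_nonneg (mul_self_nonneg (f x)),
      enorm_mul, sq]
  rw [this, ENNReal.toReal_ofNat, ENNReal.ofReal_rpow_of_nonneg hI0 (by norm_num),
    Real.sqrt_eq_rpow]

/-- Transfer of the orthogonality relations to a weighted space. -/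
lemma orthogonal_of_weighted_eq {ν : ℝ} (hν : -1 < ν) {w : ℝ → ℝ} {f : ℕ → ℝ → ℝ}
    (hw : ContinuousOn w (Ioo 0 1)) (hw0 : ∀ x ∈ Ioo (0 : ℝ) 1, 0 ≤ w x)
    (hf : ∀ n, ContinuousOn (f n) (Ioo 0 1))
    (hwf : ∀ m n, ∀ x ∈ Ioo (0 : ℝ) 1, w x * (f m x * f n x) =
      phiCoeff ν m * phiCoeff ν n * (x ^ (2 * ν + 2) / x *
        (besselD ν (besselZero ν 1 ^ 2) (besselZero ν m ^ 2) x *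
          besselD ν (besselZero ν 1 ^ 2) (besselZero ν n ^ 2) x))) :
    IsOrthogonalSystem (lebMeasure.withDensity fun x => ENNReal.ofReal (w x)) f {n | 2 ≤ n} ∧
      ∀ n, 1 ≤ n → eLpNorm (f n) 2 (lebMeasure.withDensity fun x => ENNReal.ofReal (w x)) =
        ENNReal.ofReal (Real.sqrt (besselZero ν n ^ 2 - besselZero ν 1 ^ 2)) := by
  have hpos : ∀ n, 1 ≤ n → 0 < besselZero ν n ^ 2 := fun n hn => pow_pos (besselZero_pos hν hn) 2
  have hnorm : ∀ n, 1 ≤ n →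
      eLpNorm (f n) 2 (lebMeasure.withDensity fun x => ENNReal.ofReal (w x)) =
        ENNReal.ofReal (Real.sqrt (besselZero ν n ^ 2 - besselZero ν 1 ^ 2)) := by
    intro n hn
    have hD := integral_besselD_sq hν (hpos 1 le_rfl) (besselG_besselZero hν le_rfl)
      (fun x => besselG_besselZero_one_ne_zero hν) (hpos n hn) (besselG_besselZero hν hn)
    refine eLpNorm_two_withDensity_lebMeasure hw hw0 ?_ ?_
    · exact IntegrableOn.congr_fun (hD.1.const_mul (phiCoeff ν n * phiCoeff ν n))
        (fun x hx => (hwf n n x hx).symm) measurableSet_Ioo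
    · rw [setIntegral_congr_fun measurableSet_Ioo (hwf n n), integral_const_mul, hD.2]
      linear_combination (besselZero ν n ^ 2 - besselZero ν 1 ^ 2) * phiCoeff_sq_mul hν hn
  have hwm : AEMeasurable (fun x => ENNReal.ofReal (w x)) lebMeasure :=
    (hw.aemeasurable measurableSet_Ioo).ennreal_ofReal
  refine ⟨⟨fun n hn => ?_, fun m hm n hn hmn => ?_⟩, hnorm⟩
  · have hn1 : 1 ≤ n := one_le_two.trans hn
    have hlt : besselZero ν 1 ^ 2 < besselZero ν n ^ 2 :=
      pow_lt_pow_left₀ (besselZero_strictMono hν (Nat.lt_of_succ_le hn))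
        (besselZero_nonneg hν 1) two_ne_zero
    have hm : AEStronglyMeasurable (f n) lebMeasure :=
      (hf n).aestronglyMeasurable measurableSet_Ioo
    refine ⟨⟨hm.mono_ac (withDensity_absolutelyContinuous _ _), ?_⟩, ?_⟩
    · rw [hnorm n hn1]
      exact ENNReal.ofReal_lt_top
    · rw [hnorm n hn1]
      exact (ENNReal.ofReal_pos.2 (Real.sqrt_pos.2 (sub_pos.2 hlt))).ne'
  · have hm1 : 1 ≤ m := one_le_two.trans hm
    have hn1 : 1 ≤ n := one_le_two.trans hn
    have hne : besselZero ν n ^ 2 ≠ besselZero ν m ^ 2 := fun h =>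
      hmn ((besselZero_strictMono hν).injective
        ((pow_left_inj₀ (besselZero_nonneg hν n) (besselZero_nonneg hν m) two_ne_zero).1 h)).symm
    beta_reduce
    rw [integral_withDensity_eq_integral_toReal_smul₀ hwm
      (Eventually.of_forall fun _ => ENNReal.ofReal_lt_top)]
    have h1 : ∫ x, (ENNReal.ofReal (w x)).toReal • (f m x * f n x) ∂lebMeasure =
        ∫ x in Ioo 0 1, phiCoeff ν m * phiCoeff ν n * (x ^ (2 * ν + 2) / x *
        (besselD ν (besselZero ν 1 ^ 2) (besselZero ν m ^ 2) x *
          besselD ν (besselZero ν 1 ^ 2) (besselZero ν n ^ 2) x)) := by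
      refine setIntegral_congr_fun measurableSet_Ioo fun x hx => ?_
      simp only [ENNReal.toReal_ofReal (hw0 x hx), smul_eq_mul]
      exact hwf m n x hx
    rw [h1, integral_const_mul, integral_besselD_mul hν (hpos 1 le_rfl)
      (besselG_besselZero hν le_rfl) (fun x => besselG_besselZero_one_ne_zero hν) (hpos n hn1)
      (hpos m hm1) (besselG_besselZero hν hn1) (besselG_besselZero hν hm1) hne, mul_zero]

lemma rpow_two_mul_add_one (ν : ℝ) {x : ℝ} (hx : 0 < x) :
    x ^ (2 * ν + 1) = x ^ (2 * ν + 2) / x := by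
  rw [← Real.rpow_sub_one hx.ne']; congr 1; ring

lemma continuousOn_rpow_Ioo (p : ℝ) : ContinuousOn (fun x : ℝ => x ^ p) (Ioo 0 1) :=
  continuousOn_id.rpow_const fun _ hx => Or.inl (ne_of_gt hx.1)

lemma continuousOn_phiNat {ν : ℝ} (hν : -1 < ν) (n : ℕ) :
    ContinuousOn (phiNat ν n) (Ioo 0 1) := fun _ hx =>
  (hasDerivAt_phiNat hν n hx.1).continuousAt.continuousWithinAt

end

end FourierBessel

open FourierBessel
theorem mainTheorem5 (ν : ℝ) (hν : -1 < ν) :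
    (∀ n : ℕ, 1 ≤ n →
      DifferentiableOn ℝ (phiEss ν n) (Ioo 0 1) ∧
      DifferentiableOn ℝ (phiNat ν n) (Ioo 0 1) ∧
      DifferentiableOn ℝ (psiLeb ν n) (Ioo 0 1)) ∧
    IsOrthogonalSystem (essMeasure ν) (fun n => essDeriv (phiEss ν n)) {n | 2 ≤ n} ∧
    IsOrthogonalSystem (natMeasure ν) (fun n => natDeriv ν (phiNat ν n)) {n | 2 ≤ n} ∧
    IsOrthogonalSystem lebMeasure (fun n => lebDeriv ν (psiLeb ν n)) {n | 2 ≤ n} ∧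
    (∀ n : ℕ, 1 ≤ n →
      eLpNorm (essDeriv (phiEss ν n)) 2 (essMeasure ν) =
        ENNReal.ofReal (Real.sqrt (besselZero ν n ^ 2 - besselZero ν 1 ^ 2)) ∧
      eLpNorm (natDeriv ν (phiNat ν n)) 2 (natMeasure ν) =
        ENNReal.ofReal (Real.sqrt (besselZero ν n ^ 2 - besselZero ν 1 ^ 2)) ∧
      eLpNorm (lebDeriv ν (psiLeb ν n)) 2 lebMeasure =
        ENNReal.ofReal (Real.sqrt (besselZero ν n ^ 2 - besselZero ν 1 ^ 2))) := by
  have hD : ∀ n, ContinuousOn (fun x => phiCoeff ν n *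
      besselD ν (besselZero ν 1 ^ 2) (besselZero ν n ^ 2) x) (Ioo 0 1) := fun n =>
    continuousOn_const.mul
      (continuousOn_besselD hν _ fun x => besselG_besselZero_one_ne_zero hν)
  have hess := orthogonal_of_weighted_eq hν (w := fun x => x ^ (2 * ν + 1) * phiNat ν 1 x ^ 2)
    (f := fun n => essDeriv (phiEss ν n))
    ((continuousOn_rpow_Ioo _).mul ((continuousOn_phiNat hν 1).pow 2))
    (fun x hx => by have := hx.1; positivity)
    (fun n => ((hD n).div (continuousOn_phiNat hν 1) fun x => phiNat_one_ne_zero hν).congr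
      fun x => essDeriv_phiEss hν n)
    (fun m n x hx => by
      have := phiNat_one_ne_zero hν hx
      rw [essDeriv_phiEss hν m hx, essDeriv_phiEss hν n hx, rpow_two_mul_add_one ν hx.1]
      field_simp)
  have hnat := orthogonal_of_weighted_eq hν (w := fun x => x ^ (2 * ν + 1))
    (f := fun n => natDeriv ν (phiNat ν n)) (continuousOn_rpow_Ioo _)
    (fun x hx => by have := hx.1; positivity)
    (fun n => (hD n).congr fun x => natDeriv_phiNat hν n)
    (fun m n x hx => by
      rw [natDeriv_phiNat hν m hx, natDeriv_phiNat hν n hx, rpow_two_mul_add_one ν hx.1]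
      ring)
  -- Lebesgue measure is treated as the weight 1; the factor x^{2ν+1} comes from the two factors
  -- x^{ν+1/2} in ψ_m and ψ_n.
  have hleb := orthogonal_of_weighted_eq hν (w := fun _ => 1)
    (f := fun n => lebDeriv ν (psiLeb ν n)) continuousOn_const (fun _ _ => zero_le_one)
    (fun n => ((continuousOn_rpow_Ioo _).mul (hD n)).congr fun x => lebDeriv_psiLeb hν n)
    (fun m n x hx => by
      have h : x ^ (ν + 1 / 2) * x ^ (ν + 1 / 2) = x ^ (2 * ν + 2) / x := by
        rw [← Real.rpow_add hx.1, ← rpow_two_mul_add_one ν hx.1]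
        congr 1; ring
      rw [lebDeriv_psiLeb hν m hx, lebDeriv_psiLeb hν n hx, ← h]
      ring)
  have hone : (lebMeasure.withDensity fun _ => ENNReal.ofReal 1) = lebMeasure := by
    rw [ENNReal.ofReal_one]
    exact withDensity_one
  rw [hone] at hleb
  refine ⟨fun n _ => ⟨fun x hx => ?_, fun x hx => ?_, fun x hx => ?_⟩, hess.1, hnat.1, hleb.1,
    fun n hn => ⟨hess.2 n hn, hnat.2 n hn, hleb.2 n hn⟩⟩
  · exact (hasDerivAt_phiEss hν n hx).differentiableAt.differentiableWithinAt
  · exact (hasDerivAt_phiNat hν n hx.1).differentiableAt.differentiableWithinAt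
  · exact (hasDerivAt_psiLeb hν n hx.1).differentiableAt.differentiableWithinAt
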